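/- Let $K$ be a field of characteristic $\neq 2$ and let $B,D,E\ge 0$ be integers. Let $T_\delta$ denote the Chebyshev polynomial of the first kind of degree $\delta$, and call $f=\sum_\delta c_\delta T_\delta\in K[x]$ *admissible* if at most $B$ of the $c_\delta$ are nonzero and all of these have $\delta\le D$. Choose $\omega_1,\dots,\omega_{\lfloor E/2\rfloor+1}\in K\setminus\{0\}$ of multiplicative order $\ge 4D+1$ (i.e. $\omega_\sigma^\eta\ne1$ for $1\le\eta\le 4D$). Block $\sigma$ consists of the points $\gamma_{\sigma,2i-1}=\bigl(\omega_\sigma^{2i-1}+\omega_\sigma^{-(2i-1)}\bigr)/2$ for $1\le i\le n_\sigma$, where $n_\sigma=3B$, except that $n_\sigma=2B$ for the last block if $E$ is even. Let $\hat a_{\sigma,2i-1}\in K$ be arbitrary values, one for each index $(\sigma,i)$, and extend each block evenly by $\hat a_{\sigma,-k}=\hat a_{\sigma,k}$. Consider the following list-interpolation algorithm. *Prony step* on a block of values $a$: compute a monic linear generator $\Lambda$ of least degree of the $4B$ values $(a_{2i-1})_{i=-(2B-1)}^{2B}$; fail if $\Lambda(0)=0$ or if $\Lambda$ has fewer than $\deg\Lambda$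 distinct roots in $K$; write each root as $\omega^{d_j}$ with $|d_j|\le 2D$ (else fail); solve the transposed Vandermonde system for the coefficients, obtaining a Laurent polynomial $p(x)$; if $p=\sum_{j=1}^t\frac{c_j}{2}(\omega^{-\delta_j}x^{2\delta_j}+\omega^{\delta_j}x^{-2\delta_j})$ with $t\le B$ and all $\delta_j\le D$, return $\sum_j c_jT_{\delta_j}$, otherwise fail. *One-error step* on a block of $3B$ values $\hat a$: (i) run the Prony step on $\hat a$; (ii) for each $\ell=1,\dots,2B$ put $r=2\ell-1$ if $\ell\le B$ and $r=2(\ell-B)-1$ otherwise, replace $\hat a_{2\ell-1}$ by a symbol $\alpha$ in $\bigl[\hat a_{|r+2(i+j)|}+\hat a_{|r+2(i-j)|}\bigr]_{i,j=0}^{B}$, compute all roots $\xi\in K$ of the determinant $\Delta_{2\ell-1}(\alpha)$, and for each $\xi$ replace $\hat a_{2\ell-1}$ by $\xi$ and, if the minimal linear generator of the $6B$ values $(\hat a_{2i-1})_{i=-3B+1}^{3B}$ so modified has degree $\le 2B$, run the Prony step on the modified block. Keep every polynomial returned in (i) or (ii) that disagrees with the original block at no more than one index. *Whole algorithm*: collect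 the results of the one-error step on every block of length $3B$ and, if $E$ is even, of the Prony step on the last block, of length $2B$. (An empty list means failure.) Then: 1. The number of evaluations is $N=\sum_\sigma n_\sigma=\left\lfloor\frac32E+2\right\rfloor B$. 2. The list returned contains every admissible $f$ for which $\hat a_{\sigma,2i-1}\ne f(\gamma_{\sigma,2i-1})$ for at most $E$ of the $N$ indices $(\sigma,i)$, represented by its Chebyshev term degrees and coefficients. 3. Every polynomial in the list is admissible. 4. The list has length at most $\frac E2(2B^2+2B+1)+1$ if $E$ is even, and at most $\left(\left\lfloor\frac E2\right\rfloor+1\right)(2B^2+2B+1)$ if $E$ is odd. -/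

import Mathlib

open Polynomial

namespace ChebInterp

/-! ### Chebyshev-1 representations and evaluation points -/

/-- A polynomial is represented by its Chebyshev-1 term degrees and coefficients, that is, by a
finitely supported `c : ℕ →₀ K`; the polynomial represented is `∑ c_δ T_δ(x)`. -/
noncomputable def chebPoly {K : Type*} [Field K] (c : ℕ →₀ K) : K[X] :=
  c.sum fun δ b => Polynomial.C b * Polynomial.Chebyshev.T K (δ : ℤ)

/-- At most `B` Chebyshev-1 terms, all of degree at most `D`. -/
def IsSparse {K : Type*} [Field K] (B D : ℕ) (c : ℕ →₀ K) : Prop :=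
  c.support.card ≤ B ∧ ∀ δ ∈ c.support, δ ≤ D

/-- `ω` is nonzero and has multiplicative order at least `m` (possibly infinite). -/
def HasOrderAtLeast {K : Type*} [Field K] (ω : K) (m : ℕ) : Prop :=
  ω ≠ 0 ∧ ∀ η : ℕ, 1 ≤ η → η < m → ω ^ η ≠ 1

/-- The evaluation point `(ω^(2i-1) + ω^(-(2i-1))) / 2`. -/
noncomputable def evalPoint {K : Type*} [Field K] (ω : K) (i : ℤ) : K :=
  (ω ^ (2 * i - 1) + ω ^ (-(2 * i - 1))) / 2

/-! ### Subroutines: minimal linear generator, integer logarithm, Prony -/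

/-- The monic polynomial `Λ` linearly generates the finite sequence `s r, …, s (r + n - 1)`. -/
def Generates {K : Type*} [Field K] (s : ℤ → K) (r : ℤ) (n : ℕ) (Λ : K[X]) : Prop :=
  Λ.Monic ∧ ∀ k : ℕ, k + Λ.natDegree < n →
    ∑ j ∈ Finset.range (Λ.natDegree + 1), Λ.coeff j * s (r + k + j) = 0

/-- `Λ` is a linear generator of least degree. -/
def IsMinGenerator {K : Type*} [Field K] (s : ℤ → K) (r : ℤ) (n : ℕ) (Λ : K[X]) : Prop :=
  Generates s r n Λ ∧ ∀ M : K[X], Generates s r n M → Λ.natDegree ≤ M.natDegree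

theorem exists_isMinGenerator {K : Type*} [Field K] (s : ℤ → K) (r : ℤ) (n : ℕ) :
    ∃ Λ : K[X], IsMinGenerator s r n Λ := by
  classical
  have h : ∃ d : ℕ, ∃ Λ : K[X], Generates s r n Λ ∧ Λ.natDegree = d := by
    refine ⟨n, X ^ n, ⟨monic_X_pow n, fun k hk => ?_⟩, natDegree_X_pow n⟩
    rw [natDegree_X_pow] at hk
    omega
  obtain ⟨Λ, hΛ, hd⟩ := Nat.find_spec h
  exact ⟨Λ, hΛ, fun M hM => hd ▸ Nat.find_min' h ⟨M, hM, rfl⟩⟩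

/-- The minimal linear generator of `s r, …, s (r + n - 1)`, the value computed by the
Berlekamp/Massey algorithm. It is unique when its degree is at most `n / 2`. -/
noncomputable def minGenerator {K : Type*} [Field K] (s : ℤ → K) (r : ℤ) (n : ℕ) : K[X] :=
  (exists_isMinGenerator s r n).choose

open Classical in
/-- Integer logarithm: a `δ` with `|δ| ≤ D` and `ω^δ = ρ`, or FAIL (`none`). -/
noncomputable def intLog {K : Type*} [Field K] (D : ℕ) (ω ρ : K) : Option ℤ :=
  if h : ∃ δ : ℤ, |δ| ≤ (D : ℤ) ∧ ω ^ δ = ρ then some h.choose else none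

/-- All distinct roots of `p` in `K`, in some order. -/
noncomputable def rootList {K : Type*} [Field K] (p : K[X]) : List K := by
  classical exact p.roots.toFinset.toList

open Classical in
/-- Prony's algorithm on `s r, …, s (r + n - 1)` with bound `D` on the absolute values of the term
degrees: compute the minimal linear generator, its roots `ρ_j` in `K`, the logarithms `δ_j` of the
roots, and the coefficients by solving the transposed Vandermonde system
`∑ j, ρ_j^(r+k) * c_j = s (r+k)`, `k < t`. FAIL is `none`. -/
noncomputable def prony {K : Type*} [Field K] (D : ℕ) (ω : K) (s : ℤ → K) (r : ℤ) (n : ℕ) :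
    Option (LaurentPolynomial K) :=
  let Λ := minGenerator s r n
  let ρs := rootList Λ
  let t := ρs.length
  let ρ : Fin t → K := ρs.get
  if Λ.coeff 0 = 0 then none
  else if t < Λ.natDegree then none
  else if ∃ j, intLog D ω (ρ j) = none then none
  else
    let V : Matrix (Fin t) (Fin t) K := Matrix.of fun k j => ρ j ^ (r + (k : ℕ))
    let c : Fin t → K := V⁻¹.mulVec fun k => s (r + (k : ℕ))
    some (∑ j, LaurentPolynomial.C (c j) * LaurentPolynomial.T ((intLog D ω (ρ j)).getD 0))

/-! ### One block -/

/-- The values `â_1, â_3, …, â_{2n-1}` (stored in `v 0, …, v (n-1)`) as a function of the odd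
integer index, extended evenly: `â_{-k} = â_k`. -/
def oddVal {R : Type*} [Zero R] {n : ℕ} (v : Fin n → R) (k : ℤ) : R :=
  if h : (k.natAbs - 1) / 2 < n then v ⟨(k.natAbs - 1) / 2, h⟩ else 0

/-- The sequence `i ↦ â_{2i-1}`, `i ∈ ℤ`. -/
def oddSeq {R : Type*} [Zero R] {n : ℕ} (v : Fin n → R) (i : ℤ) : R :=
  oddVal v (2 * i - 1)

/-- The Hankel + Toeplitz matrix `[â_{|r+2(i+j)|} + â_{|r+2(i-j)|}]`, `0 ≤ i, j ≤ B`. -/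
def foldMatrix {R : Type*} [Semiring R] {n : ℕ} (B : ℕ) (v : Fin n → R) (r : ℤ) :
    Matrix (Fin (B + 1)) (Fin (B + 1)) R :=
  Matrix.of fun i j =>
    oddVal v |r + 2 * (((i : ℕ) : ℤ) + ((j : ℕ) : ℤ))|
      + oddVal v |r + 2 * (((i : ℕ) : ℤ) - ((j : ℕ) : ℤ))|

/-- The Laurent polynomial `∑ (c_δ/2) (ω^(-δ) x^(2δ) + ω^δ x^(-2δ))`. -/
noncomputable def chebLaurent {K : Type*} [Field K] (ω : K) (c : ℕ →₀ K) : LaurentPolynomial K :=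
  c.sum fun δ b =>
    LaurentPolynomial.C (b / 2 * ω ^ (-(δ : ℤ))) * LaurentPolynomial.T (2 * (δ : ℤ))
      + LaurentPolynomial.C (b / 2 * ω ^ (δ : ℤ)) * LaurentPolynomial.T (-(2 * (δ : ℤ)))

open Classical in
/-- If `p` is `∑_{j ≤ t} (c_j/2) (ω^(-δ_j) x^(2δ_j) + ω^(δ_j) x^(-2δ_j))` with `t ≤ B` and all
`δ_j ≤ D`, return the term degrees `δ_j` and coefficients `c_j`, otherwise FAIL. -/
noncomputable def chebOfLaurent {K : Type*} [Field K] (B D : ℕ) (ω : K) (p : LaurentPolynomial K) :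
    Option (ℕ →₀ K) :=
  if h : ∃ c : ℕ →₀ K, IsSparse B D c ∧ p = chebLaurent ω c then some h.choose else none

/-- Chebyshev-1 interpolation without error correction: Prony's algorithm on the `4B` values
`â_{2i-1}`, `-(2B-1) ≤ i ≤ 2B`, term degrees of the Laurent polynomial bounded by `2D`. -/
noncomputable def chebProny {K : Type*} [Field K] {n : ℕ} (B D : ℕ) (ω : K) (v : Fin n → K) :
    Option (ℕ →₀ K) :=
  (prony (2 * D) ω (oddSeq v) (-(2 * (B : ℤ) - 1)) (4 * B)).bind (chebOfLaurent B D ω)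

/-- The indices at which the polynomial represented by `c` disagrees with the values `v`, where
`v i` is the value received for the point `evalPoint ω (i + 1)`. -/
def blockErrors {K : Type*} [Field K] {n : ℕ} (ω : K) (v : Fin n → K) (c : ℕ →₀ K) :
    Set (Fin n) :=
  {i | v i ≠ (chebPoly c).eval (evalPoint ω ((i : ℕ) + 1))}

open Classical in
/-- Run `chebProny` on the (possibly modified) values `w`; keep the result only if it disagrees
with the received values `v` at no more than one index. -/
noncomputable def tryBlock {K : Type*} [Field K] {n : ℕ} (B D : ℕ) (ω : K) (v w : Fin n → K) :
    List (ℕ →₀ K) :=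
  match chebProny B D ω w with
  | none => []
  | some c => if (blockErrors ω v c).ncard ≤ 1 then [c] else []

/-- The determinant `Δ(α)`, `α` the polynomial variable, obtained by substituting `α` for the value
with (zero-based) index `ℓ`. With `ℓ' = ℓ + 1`, the matrix is the one for `r = 2ℓ' - 1` if
`ℓ' ≤ B`, and the one for `r = 2(ℓ' - B) - 1` if `B < ℓ' ≤ 2B`. -/
noncomputable def symbolicDet {K : Type*} [Field K] {n : ℕ} (B : ℕ) (v : Fin n → K) (ℓ : Fin n) :
    K[X] :=
  (foldMatrix B (Function.update (fun i => Polynomial.C (v i)) ℓ X)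
    (if (ℓ : ℕ) < B then 2 * (((ℓ : ℕ) : ℤ) + 1) - 1
      else 2 * (((ℓ : ℕ) : ℤ) + 1 - (B : ℤ)) - 1)).det

/-- List interpolation from a block of `3B` values with at most one error.
The empty list means FAIL. -/
noncomputable def oneErrorList {K : Type*} [Field K] {n : ℕ} (B D : ℕ) (ω : K) (v : Fin n → K) :
    List (ℕ →₀ K) :=
  tryBlock B D ω v v ++
    ((List.finRange n).filter fun ℓ : Fin n => ℓ.val < 2 * B).flatMap fun ℓ =>
      (rootList (symbolicDet B v ℓ)).flatMap fun ξ =>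
        if (minGenerator (oddSeq (Function.update v ℓ ξ)) (-(3 * (B : ℤ)) + 1) (6 * B)).natDegree
            ≤ 2 * B
        then tryBlock B D ω v (Function.update v ℓ ξ) else []

/-! ### Blocking -/

/-- There are `⌊E/2⌋ + 1` blocks. All have length `3B`, except that the last one has length `2B`
when `E` is even. -/
def blockLength (B E : ℕ) (σ : Fin (E / 2 + 1)) : ℕ :=
  if (σ : ℕ) < E / 2 ∨ Odd E then 3 * B else 2 * B

/-- The index set of all evaluations: a block `σ` and a position in it. -/
abbrev EvalIndex (B E : ℕ) : Type := Σ σ : Fin (E / 2 + 1), Fin (blockLength B E σ)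

/-- List interpolation with at most `E` errors: the one-error algorithm on every block of length
`3B`, and interpolation without error correction on the last block if it has length `2B`. -/
noncomputable def listInterpolate {K : Type*} [Field K] (B D E : ℕ) (ω : Fin (E / 2 + 1) → K)
    (a : EvalIndex B E → K) : List (ℕ →₀ K) :=
  (List.finRange (E / 2 + 1)).flatMap fun σ : Fin (E / 2 + 1) =>
    if σ.val < E / 2 ∨ Odd E then oneErrorList B D (ω σ) fun i => a ⟨σ, i⟩
    else (chebProny B D (ω σ) fun i => a ⟨σ, i⟩).toList

end ChebInterp

open ChebInterp

/-!
The odd-indexed values of a Chebyshev expansion with at most `B` terms form an exponential sum with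
at most `2 B` distinct bases `ω^(±2δ)`, `|2δ| ≤ 2D`; the order hypothesis makes the bases distinct
and the logarithms unique. Evaluating a minimal recurrence of such a sum gives a nonsingular
Vandermonde system, which forces all bases to be roots; hence the minimal generator is the product
of the linear factors (`minGenerator_eq_prod`) and Prony's algorithm recovers the polynomial from
`4 B` values of the symmetric sequence, that is, from `2 B` correct values (`prony_eq_some`,
`chebProny_eq_some`).

A single error in a block of `3 B` values either lies beyond the first `2 B` values, where Prony's
algorithm does not look, or it is undone by a root of `symbolicDet`. The true value is a root since
the Hankel + Toeplitz matrix of a correct block has rank at most `B` (`det_foldMatrix_eq_zero`). It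
is found since `symbolicDet` is never the zero polynomial: its coefficient of degree `B + 1` is, up
to sign, equal to `2` (`symbolicDet_ne_zero` rests on `det_foldMatrix_single_ne_zero`). The same
degree bounds the number of roots, hence the number of candidates (`length_oneErrorList_le`).

Finally, `E` errors cannot spoil all blocks: some block of length `3 B` has at most one error, or the
last block, of length `2 B`, has none (`exists_good_block`).
-/

namespace ChebInterp

/-! ### Powers of an element of large order -/

theorem HasOrderAtLeast.mono {K : Type*} [Field K] {ω : K} {m n : ℕ}
    (h : HasOrderAtLeast ω n) (hmn : m ≤ n) : HasOrderAtLeast ω m :=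
  ⟨h.1, fun η h1 h2 => h.2 η h1 (h2.trans_le hmn)⟩

theorem HasOrderAtLeast.zpow_injOn {K : Type*} [Field K] {ω : K} {D : ℕ}
    (h : HasOrderAtLeast ω (2 * D + 1)) {d e : ℤ} (hd : |d| ≤ D) (he : |e| ≤ D)
    (hde : ω ^ d = ω ^ e) : d = e := by
  wlog hlt : d < e generalizing d e with H
  · rcases eq_or_lt_of_not_gt hlt with h' | h'
    · exact h'.symm
    · exact (H he hd hde.symm h').symm
  exfalso
  rw [abs_le] at hd he
  refine h.2 (e - d).toNat (by omega) (by omega) ?_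
  rw [← zpow_natCast, Int.toNat_of_nonneg (by omega), zpow_sub₀ h.1, hde,
    div_self (zpow_ne_zero _ h.1)]

theorem HasOrderAtLeast.intLog_zpow {K : Type*} [Field K] {ω : K} {D : ℕ}
    (h : HasOrderAtLeast ω (2 * D + 1)) {e : ℤ} (he : |e| ≤ D) :
    intLog D ω (ω ^ e) = some e := by
  have hex : ∃ δ : ℤ, |δ| ≤ (D : ℤ) ∧ ω ^ δ = ω ^ e := ⟨e, he, rfl⟩
  rw [intLog, dif_pos hex, h.zpow_injOn hex.choose_spec.1 he hex.choose_spec.2]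

/-! ### Lists of roots -/

theorem nodup_rootList {K : Type*} [Field K] (p : K[X]) : (rootList p).Nodup := by
  classical
  exact Finset.nodup_toList _

theorem mem_rootList {K : Type*} [Field K] {p : K[X]} (hp : p ≠ 0) {x : K} :
    x ∈ rootList p ↔ p.eval x = 0 := by
  classical
  simp [rootList, hp]

open Classical in
theorem mem_rootList_iff {K : Type*} [Field K] {p : K[X]} {x : K} :
    x ∈ rootList p ↔ x ∈ p.roots.toFinset := by
  rw [rootList, Finset.mem_toList]

open Classical in
theorem length_rootList {K : Type*} [Field K] (p : K[X]) :
    (rootList p).length = p.roots.toFinset.card := by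
  rw [rootList, Finset.length_toList]

open Classical in
theorem sum_rootList_get {K M : Type*} [Field K] [AddCommMonoid M] (p : K[X]) (F : K → M) :
    ∑ j, F ((rootList p).get j) = ∑ x ∈ p.roots.toFinset, F x := by
  rw [← Finset.sum_map_toList _ F, ← List.sum_ofFn]
  congr 1
  refine Eq.trans (b := (List.ofFn (rootList p).get).map F) List.map_ofFn.symm ?_
  rw [List.ofFn_get, rootList]

theorem length_rootList_le {K : Type*} [Field K] (p : K[X]) :
    (rootList p).length ≤ p.natDegree := by
  classical
  rw [rootList, Finset.length_toList]
  exact (Multiset.toFinset_card_le _).trans (card_roots' p)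

/-! ### Prony's algorithm -/

/-- A nonsingular transposed Vandermonde system, indexed by a finite set, has a trivial kernel. -/
theorem eq_zero_of_sum_mul_pow_eq_zero {K ι : Type*} [Field K] {S : Finset ι} {g x : ι → K}
    (hx : Set.InjOn x S) (h : ∀ k < S.card, ∑ e ∈ S, g e * x e ^ k = 0) : ∀ e ∈ S, g e = 0 := by
  intro e he
  have key := Matrix.eq_zero_of_forall_pow_sum_mul_pow_eq_zero
    (f := fun i => x (S.equivFin.symm i)) (v := fun i => g (S.equivFin.symm i))
    (fun i j hij => S.equivFin.symm.injective
      (Subtype.ext (hx (S.equivFin.symm i).2 (S.equivFin.symm j).2 hij)))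
    (fun i => by
      rw [← h i i.2, ← Finset.sum_coe_sort S]
      exact Equiv.sum_comp S.equivFin.symm (fun e : S => g e * x e ^ (i : ℕ)))
  simpa using congrFun key (S.equivFin ⟨e, he⟩)

/-- Applying the recurrence with coefficients `Λ` to an exponential sum multiplies each term by the
value of `Λ` at its base. -/
theorem sum_coeff_mul_expSum {K : Type*} [Field K] {ω : K} (hω : ω ≠ 0) (S : Finset ℤ) (b : ℤ → K)
    (Λ : K[X]) (m : ℤ) :
    ∑ j ∈ Finset.range (Λ.natDegree + 1), Λ.coeff j * ∑ e ∈ S, b e * ω ^ (e * (m + j)) =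
      ∑ e ∈ S, b e * ω ^ (e * m) * Λ.eval (ω ^ e) := by
  simp_rw [eval_eq_sum_range, Finset.mul_sum]
  rw [Finset.sum_comm]
  refine Finset.sum_congr rfl fun e _ => Finset.sum_congr rfl fun j _ => ?_
  rw [mul_add, zpow_add₀ hω, zpow_mul ω e j, zpow_natCast]
  ring

/-- The monic polynomial whose roots are the bases of an exponential sum generates it. -/
theorem generates_prod_X_sub_C {K : Type*} [Field K] {ω : K} (hω : ω ≠ 0) {S : Finset ℤ}
    {b : ℤ → K} {s : ℤ → K} {r : ℤ} {n : ℕ}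
    (hs : ∀ k < n, s (r + k) = ∑ e ∈ S, b e * ω ^ (e * (r + k))) :
    Generates s r n (∏ e ∈ S, (X - C (ω ^ e))) := by
  refine ⟨monic_prod_of_monic _ _ fun e _ => monic_X_sub_C _, fun k hk => ?_⟩
  have := sum_coeff_mul_expSum hω S b (∏ e ∈ S, (X - C (ω ^ e))) (r + k)
  calc _ = _ := Finset.sum_congr rfl fun j hj => by
        rw [Finset.mem_range] at hj
        have h := hs (k + j) (by omega)
        rw [Nat.cast_add, ← add_assoc] at h
        rw [h]
    _ = _ := this
    _ = 0 := Finset.sum_eq_zero fun e he => by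
        rw [eval_prod, Finset.prod_eq_zero he (by simp), mul_zero]

theorem natDegree_minGenerator_le {K : Type*} [Field K] {ω : K} (hω : ω ≠ 0) {S : Finset ℤ}
    {b : ℤ → K} {s : ℤ → K} {r : ℤ} {n : ℕ}
    (hs : ∀ k < n, s (r + k) = ∑ e ∈ S, b e * ω ^ (e * (r + k))) :
    (minGenerator s r n).natDegree ≤ S.card := by
  have h := (exists_isMinGenerator s r n).choose_spec.2 _ (generates_prod_X_sub_C hω hs)
  rwa [natDegree_prod_of_monic _ _ fun e _ => monic_X_sub_C _, Finset.sum_congr rfl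
    fun e _ => natDegree_X_sub_C _, Finset.sum_const, smul_eq_mul, mul_one] at h

/-- The minimal generator of an exponential sum with `m` terms is determined by `2 m` of its
values: evaluating the recurrence at `m` consecutive places gives a Vandermonde system which forces
every base to be a root. -/
theorem minGenerator_eq_prod {K : Type*} [Field K] {ω : K} (hω : ω ≠ 0) {S : Finset ℤ}
    {b : ℤ → K} {s : ℤ → K} {r : ℤ} {n : ℕ} (hinj : Set.InjOn (fun e : ℤ => ω ^ e) S)
    (hb : ∀ e ∈ S, b e ≠ 0) (hn : 2 * S.card ≤ n)
    (hs : ∀ k < n, s (r + k) = ∑ e ∈ S, b e * ω ^ (e * (r + k))) :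
    minGenerator s r n = ∏ e ∈ S, (X - C (ω ^ e)) := by
  have hdeg := natDegree_minGenerator_le hω hs
  obtain ⟨hmon, hgen⟩ := (exists_isMinGenerator s r n).choose_spec.1
  change (minGenerator s r n).Monic at hmon
  change ∀ k : ℕ, k + (minGenerator s r n).natDegree < n → ∑ j ∈ Finset.range
    ((minGenerator s r n).natDegree + 1), (minGenerator s r n).coeff j * s (r + k + j) = 0 at hgen
  set Λ := minGenerator s r n
  have hroot : ∀ e ∈ S, Λ.eval (ω ^ e) = 0 := by
    intro e he
    have := eq_zero_of_sum_mul_pow_eq_zero (g := fun e => b e * ω ^ (e * r) * Λ.eval (ω ^ e)) hinj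
      (fun k hk => by
        rw [← hgen k (by omega)]
        have h := sum_coeff_mul_expSum hω S b Λ (r + k)
        calc _ = ∑ e ∈ S, b e * ω ^ (e * (r + k)) * Λ.eval (ω ^ e) :=
              Finset.sum_congr rfl fun e _ => by
                rw [mul_add, zpow_add₀ hω, zpow_mul ω e k, zpow_natCast]; ring
          _ = _ := h.symm
          _ = _ := Finset.sum_congr rfl fun j hj => by
            rw [Finset.mem_range] at hj
            have h := hs (k + j) (by omega)
            rw [Nat.cast_add, ← add_assoc] at h
            rw [h]) e he
    simpa [hb e he, zpow_ne_zero _ hω] using this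
  have hdvd : ∏ e ∈ S, (X - C (ω ^ e)) ∣ Λ := by
    refine Finset.prod_dvd_of_coprime (fun d hd e he hde => ?_) fun e he =>
      dvd_iff_isRoot.mpr (hroot e he)
    exact isCoprime_X_sub_C_of_isUnit_sub (sub_ne_zero.mpr fun h => hde (hinj hd he h)).isUnit
  refine eq_of_monic_of_dvd_of_natDegree_le
    (monic_prod_of_monic _ _ fun e _ => monic_X_sub_C _) hmon hdvd ?_
  rwa [natDegree_prod_of_monic _ _ fun e _ => monic_X_sub_C _, Finset.sum_congr rfl
    fun e _ => natDegree_X_sub_C _, Finset.sum_const, smul_eq_mul, mul_one]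

/-- Prony's algorithm recovers a Laurent polynomial from twice as many values as it has terms. -/
theorem prony_eq_some {K : Type*} [Field K] {D : ℕ} {ω : K} (hω : HasOrderAtLeast ω (2 * D + 1))
    {p : LaurentPolynomial K} (hD : ∀ e ∈ p.coeff.support, |e| ≤ D) {s : ℤ → K} {r : ℤ} {n : ℕ}
    (hn : 2 * p.coeff.support.card ≤ n)
    (hs : ∀ k < n, s (r + k) = ∑ e ∈ p.coeff.support, p.coeff e * ω ^ (e * (r + k))) :
    prony D ω s r n = some p := by
  classical
  have hinj : Set.InjOn (fun e : ℤ => ω ^ e) p.coeff.support :=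
    fun d hd e he h => hω.zpow_injOn (hD d hd) (hD e he) h
  have hΛ := minGenerator_eq_prod hω.1 hinj (fun e he => Finsupp.mem_support_iff.mp he) hn hs
  have hroots : (minGenerator s r n).roots.toFinset =
      p.coeff.support.image (fun e : ℤ => ω ^ e) := by
    ext x
    rw [hΛ, Multiset.mem_toFinset, mem_roots (monic_prod_of_monic _ _ fun e _ =>
      monic_X_sub_C _).ne_zero, IsRoot.def, eval_prod, Finset.prod_eq_zero_iff]
    simp only [Finset.mem_image, eval_sub, eval_X, eval_C, sub_eq_zero, eq_comm]
  have hmem : ∀ j, ∃ e ∈ p.coeff.support,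
      ω ^ e = (rootList (minGenerator s r n)).get j := fun j => by
    have hj := List.get_mem (rootList (minGenerator s r n)) j
    rwa [mem_rootList_iff, hroots, Finset.mem_image] at hj
  have hlen : (rootList (minGenerator s r n)).length = p.coeff.support.card := by
    rw [length_rootList, hroots, Finset.card_image_of_injOn hinj]
  unfold prony
  dsimp only
  rw [if_neg, if_neg, if_neg]
  · congr 1
    set ρs := rootList (minGenerator s r n) with hρs
    -- the solution of the transposed Vandermonde system
    let c : Fin ρs.length → K := fun j => p.coeff ((intLog D ω (ρs.get j)).getD 0)
    let V : Matrix (Fin ρs.length) (Fin ρs.length) K :=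
      Matrix.of fun k j => ρs.get j ^ (r + (k : ℕ))
    have hV : V.mulVec c = fun k : Fin ρs.length => s (r + (k : ℕ)) := by
      funext k
      rw [hs k (by omega)]
      refine (sum_rootList_get _ (fun x : K => x ^ (r + (k : ℕ)) *
        p.coeff ((intLog D ω x).getD 0))).trans ?_
      rw [hroots, Finset.sum_image hinj]
      refine Finset.sum_congr rfl fun e he => ?_
      rw [hω.intLog_zpow (hD e he), Option.getD_some, mul_comm, zpow_mul]
    have hdet : IsUnit V.det := by
      rw [isUnit_iff_ne_zero, Ne, ← Matrix.exists_mulVec_eq_zero_iff]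
      rintro ⟨g, hg0, hg⟩
      have hne : ∀ j, ρs.get j ≠ 0 := fun j => by
        obtain ⟨e, -, he⟩ := hmem j
        exact he ▸ zpow_ne_zero _ hω.1
      refine hg0 (funext fun j => ?_)
      have := eq_zero_of_sum_mul_pow_eq_zero (S := Finset.univ) (x := ρs.get)
        (g := fun j => g j * ρs.get j ^ r)
        ((List.nodup_iff_injective_get.mp (nodup_rootList _)).injOn) (fun k hk => by
          rw [Finset.card_fin] at hk
          refine Eq.trans (Finset.sum_congr rfl fun j _ => ?_) (congrFun hg ⟨k, hk⟩)
          change _ = ρs.get j ^ (r + (k : ℤ)) * g j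
          rw [zpow_add₀ (hne j), zpow_natCast]
          ring) j (Finset.mem_univ j)
      exact (mul_eq_zero.mp this).resolve_right (zpow_ne_zero _ (hne j))
    change ∑ j, LaurentPolynomial.C (V⁻¹.mulVec (fun k => s (r + (k : ℕ))) j) *
      LaurentPolynomial.T ((intLog D ω (ρs.get j)).getD 0) = p
    rw [← hV, Matrix.mulVec_mulVec, Matrix.nonsing_inv_mul _ hdet, Matrix.one_mulVec]
    calc _ = _ := sum_rootList_get _ (fun x : K => LaurentPolynomial.C
          (p.coeff ((intLog D ω x).getD 0)) * LaurentPolynomial.T ((intLog D ω x).getD 0))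
      _ = ∑ e ∈ p.coeff.support, LaurentPolynomial.C (p.coeff e) * LaurentPolynomial.T e := by
        rw [hroots, Finset.sum_image hinj]
        refine Finset.sum_congr rfl fun e he => ?_
        rw [hω.intLog_zpow (hD e he), Option.getD_some]
      _ = p := by
        simp_rw [← LaurentPolynomial.single_eq_C_mul_T]
        exact p.sum_coeff_single
  · rintro ⟨j, hj⟩
    obtain ⟨e, he, hje⟩ := hmem j
    rw [← hje, hω.intLog_zpow (hD e he)] at hj
    exact absurd hj (by simp)
  · rw [hlen, not_lt]
    exact natDegree_minGenerator_le hω.1 hs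
  · rw [hΛ, coeff_zero_eq_eval_zero, eval_prod, Finset.prod_eq_zero_iff]
    rintro ⟨e, -, he⟩
    simp [zpow_ne_zero _ hω.1] at he

/-! ### Values of Chebyshev expansions as exponential sums -/

/-- The value `∑ c_δ (ω^(δk) + ω^(-δk)) / 2` of `∑ c_δ T_δ` at `(ω^k + ω^(-k)) / 2`, as a function
of the exponent `k`. -/
noncomputable def chebValue {K : Type*} [Field K] (ω : K) (c : ℕ →₀ K) (k : ℤ) : K :=
  c.sum fun δ b => b * ((ω ^ ((δ : ℤ) * k) + ω ^ (-((δ : ℤ) * k))) / 2)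

theorem chebValue_abs {K : Type*} [Field K] (ω : K) (c : ℕ →₀ K) (k : ℤ) :
    chebValue ω c |k| = chebValue ω c k := by
  rcases abs_choice k with h | h <;> rw [h]
  simp only [chebValue, mul_neg, neg_neg, add_comm]

theorem eval_chebyshevT {K : Type*} [Field K] (hK : (2 : K) ≠ 0) {z : K} (hz : z ≠ 0) (n : ℕ) :
    (Chebyshev.T K (n : ℤ)).eval ((z + z⁻¹) / 2) = (z ^ n + (z ^ n)⁻¹) / 2 := by
  induction n using Nat.twoStepInduction with
  | zero => simp [one_add_one_eq_two, hK]
  | one => simp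
  | more n h0 h1 =>
    rw [Nat.cast_succ] at h1
    push_cast
    rw [Chebyshev.T_add_two]
    simp only [eval_sub, eval_mul, eval_X, eval_ofNat, h0, h1]
    field_simp
    ring

theorem eval_chebPoly_evalPoint {K : Type*} [Field K] (hK : (2 : K) ≠ 0) {ω : K} (hω : ω ≠ 0)
    (c : ℕ →₀ K) (i : ℤ) :
    (chebPoly c).eval (evalPoint ω i) = chebValue ω c (2 * i - 1) := by
  rw [chebPoly, chebValue, Finsupp.sum, Finsupp.sum, eval_finsetSum]
  refine Finset.sum_congr rfl fun δ _ => ?_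
  rw [eval_mul, eval_C, evalPoint, zpow_neg, eval_chebyshevT hK (zpow_ne_zero _ hω), zpow_neg,
    mul_comm (δ : ℤ), zpow_mul, zpow_natCast]

/-- The evaluation of a Laurent polynomial at `ω^i`, as a sum over its terms. -/
theorem eval₂_eq_sum_support {K : Type*} [Field K] {ω : K} (hω : ω ≠ 0)
    (p : LaurentPolynomial K) (i : ℤ) :
    LaurentPolynomial.eval₂ (RingHom.id K) (Units.mk0 ω hω ^ i) p =
      ∑ e ∈ p.coeff.support, p.coeff e * ω ^ (e * i) := by
  conv_lhs => rw [← p.sum_coeff_single]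
  rw [Finsupp.sum, map_sum]
  refine Finset.sum_congr rfl fun e _ => ?_
  rw [LaurentPolynomial.single_eq_C_mul_T, LaurentPolynomial.eval₂_C_mul_T, RingHom.id_apply,
    ← zpow_mul, mul_comm i, Units.val_zpow_eq_zpow_val, Units.val_mk0]

theorem sum_coeff_chebLaurent {K : Type*} [Field K] {ω : K} (hω : ω ≠ 0) (c : ℕ →₀ K) (i : ℤ) :
    ∑ e ∈ (chebLaurent ω c).coeff.support, (chebLaurent ω c).coeff e * ω ^ (e * i) =
      chebValue ω c (2 * i - 1) := by
  rw [← eval₂_eq_sum_support hω, chebLaurent, chebValue, Finsupp.sum, Finsupp.sum, map_sum]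
  refine Finset.sum_congr rfl fun δ _ => ?_
  simp only [map_add, LaurentPolynomial.eval₂_C_mul_T, RingHom.id_apply, ← zpow_mul,
    Units.val_zpow_eq_zpow_val, Units.val_mk0]
  rw [show (δ : ℤ) * (2 * i - 1) = -δ + i * (2 * δ) by ring,
    show -(-(δ : ℤ) + i * (2 * δ)) = δ + i * -(2 * δ) by ring, zpow_add₀ hω, zpow_add₀ hω]
  ring

theorem coeff_chebLaurent {K : Type*} [Field K] (ω : K) (c : ℕ →₀ K) (e : ℤ) :
    (chebLaurent ω c).coeff e = ∑ δ ∈ c.support,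
      ((if 2 * (δ : ℤ) = e then c δ / 2 * ω ^ (-(δ : ℤ)) else 0) +
        if -(2 * (δ : ℤ)) = e then c δ / 2 * ω ^ (δ : ℤ) else 0) := by
  simp only [chebLaurent, ← LaurentPolynomial.single_eq_C_mul_T, Finsupp.sum,
    AddMonoidAlgebra.coeff_sum, Finsupp.finsetSum_apply, AddMonoidAlgebra.coeff_add,
    AddMonoidAlgebra.coeff_single, Finsupp.add_apply, Finsupp.single_apply]

theorem coeff_chebLaurent_two_mul {K : Type*} [Field K] (hK : (2 : K) ≠ 0) (ω : K) (c : ℕ →₀ K)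
    (δ : ℕ) : (chebLaurent ω c).coeff (2 * (δ : ℤ)) =
      c δ * if δ = 0 then 1 else ω ^ (-(δ : ℤ)) / 2 := by
  rw [coeff_chebLaurent, Finset.sum_eq_single δ]
  · rcases eq_or_ne δ 0 with rfl | h
    · simp [← mul_two, hK]
    · rw [if_pos rfl, if_neg (by omega), if_neg h]
      ring
  · intro d _ hd
    rw [if_neg (by omega), if_neg (by omega), add_zero]
  · intro h
    simp [Finsupp.notMem_support_iff.mp h]

theorem chebLaurent_injective {K : Type*} [Field K] (hK : (2 : K) ≠ 0) {ω : K} (hω : ω ≠ 0) :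
    Function.Injective (chebLaurent ω) := by
  intro c c' h
  ext δ
  have := congrArg (fun p => p.coeff (2 * (δ : ℤ))) h
  simp only [coeff_chebLaurent_two_mul hK] at this
  refine mul_right_cancel₀ ?_ this
  split_ifs
  · exact one_ne_zero
  · exact div_ne_zero (zpow_ne_zero _ hω) hK

theorem support_chebLaurent_subset {K : Type*} [Field K] (ω : K) (c : ℕ →₀ K) :
    (chebLaurent ω c).coeff.support ⊆ c.support.image (fun δ : ℕ => 2 * (δ : ℤ)) ∪
      c.support.image (fun δ : ℕ => -(2 * (δ : ℤ))) := by
  intro e he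
  rw [Finsupp.mem_support_iff, coeff_chebLaurent] at he
  obtain ⟨δ, hδ, hne⟩ := Finset.exists_ne_zero_of_sum_ne_zero he
  rw [Finset.mem_union, Finset.mem_image, Finset.mem_image]
  by_cases h : 2 * (δ : ℤ) = e
  · exact Or.inl ⟨δ, hδ, h⟩
  · refine Or.inr ⟨δ, hδ, ?_⟩
    by_contra h'
    exact hne (by rw [if_neg h, if_neg h', add_zero])

theorem IsSparse.card_support_chebLaurent_le {K : Type*} [Field K] {B D : ℕ} {c : ℕ →₀ K}
    (hc : IsSparse B D c) (ω : K) : (chebLaurent ω c).coeff.support.card ≤ 2 * B :=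
  calc _ ≤ _ := Finset.card_le_card (support_chebLaurent_subset ω c)
    _ ≤ _ := Finset.card_union_le _ _
    _ ≤ c.support.card + c.support.card := add_le_add Finset.card_image_le Finset.card_image_le
    _ ≤ 2 * B := by have := hc.1; omega

theorem IsSparse.abs_le_of_mem_support_chebLaurent {K : Type*} [Field K] {B D : ℕ} {c : ℕ →₀ K}
    (hc : IsSparse B D c) (ω : K) {e : ℤ} (he : e ∈ (chebLaurent ω c).coeff.support) :
    |e| ≤ ((2 * D : ℕ) : ℤ) := by
  have h := support_chebLaurent_subset ω c he
  rw [Finset.mem_union, Finset.mem_image, Finset.mem_image] at h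
  rw [abs_le]
  rcases h with ⟨δ, hδ, rfl⟩ | ⟨δ, hδ, rfl⟩ <;>
  · have := hc.2 δ hδ
    constructor <;> omega

theorem chebOfLaurent_chebLaurent {K : Type*} [Field K] (hK : (2 : K) ≠ 0) {B D : ℕ} {ω : K}
    (hω : ω ≠ 0) {c : ℕ →₀ K} (hc : IsSparse B D c) :
    chebOfLaurent B D ω (chebLaurent ω c) = some c := by
  have h : ∃ c' : ℕ →₀ K, IsSparse B D c' ∧ chebLaurent ω c = chebLaurent ω c' := ⟨c, hc, rfl⟩
  rw [chebOfLaurent, dif_pos h, chebLaurent_injective hK hω h.choose_spec.2.symm]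

theorem isSparse_of_chebOfLaurent_eq_some {K : Type*} [Field K] {B D : ℕ} {ω : K}
    {p : LaurentPolynomial K} {c : ℕ →₀ K} (h : chebOfLaurent B D ω p = some c) :
    IsSparse B D c := by
  unfold chebOfLaurent at h
  split_ifs at h with hex
  rw [← Option.some.inj h]
  exact hex.choose_spec.1

theorem isSparse_of_chebProny_eq_some {K : Type*} [Field K] {n B D : ℕ} {ω : K} {v : Fin n → K}
    {c : ℕ →₀ K} (h : chebProny B D ω v = some c) : IsSparse B D c := by
  obtain ⟨p, -, hp⟩ := Option.bind_eq_some_iff.mp h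
  exact isSparse_of_chebOfLaurent_eq_some hp

/-! ### Interpolation from a block of correct values -/

/-- If the first `m` values of a block are correct, then so are the odd-indexed values of absolute
index below `2 m`. -/
theorem oddVal_eq_chebValue {K : Type*} [Field K] (hK : (2 : K) ≠ 0) {ω : K} (hω : ω ≠ 0)
    {n m : ℕ} (hm : m ≤ n) {v : Fin n → K} {c : ℕ →₀ K}
    (hv : ∀ i : Fin n, (i : ℕ) < m → v i = (chebPoly c).eval (evalPoint ω ((i : ℕ) + 1)))
    {k : ℤ} (hodd : Odd k) (hk : |k| < 2 * m) : oddVal v k = chebValue ω c k := by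
  obtain ⟨l, rfl⟩ := hodd
  have hlt : ((2 * l + 1).natAbs - 1) / 2 < m := by
    rw [Int.abs_eq_natAbs] at hk
    omega
  rw [oddVal, dif_pos (hlt.trans_le hm), hv _ hlt, eval_chebPoly_evalPoint hK hω,
    ← chebValue_abs ω c (2 * l + 1), Int.abs_eq_natAbs]
  congr 1
  simp only
  omega

theorem oddSeq_eq_sum_chebLaurent {K : Type*} [Field K] (hK : (2 : K) ≠ 0) {ω : K} (hω : ω ≠ 0)
    {n m : ℕ} (hm : m ≤ n) {v : Fin n → K} {c : ℕ →₀ K}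
    (hv : ∀ i : Fin n, (i : ℕ) < m → v i = (chebPoly c).eval (evalPoint ω ((i : ℕ) + 1)))
    {i : ℤ} (hi : |2 * i - 1| < 2 * m) : oddSeq v i =
      ∑ e ∈ (chebLaurent ω c).coeff.support, (chebLaurent ω c).coeff e * ω ^ (e * i) := by
  rw [sum_coeff_chebLaurent hω, oddSeq,
    oddVal_eq_chebValue hK hω hm hv ⟨i - 1, by ring⟩ hi]

/-- Interpolation without error correction only looks at the first `2 B` values of the block, and
recovers the polynomial if these are correct. -/
theorem chebProny_eq_some {K : Type*} [Field K] (hK : (2 : K) ≠ 0) {B D n : ℕ} {ω : K}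
    (hω : HasOrderAtLeast ω (4 * D + 1)) (hn : 2 * B ≤ n) {v : Fin n → K} {c : ℕ →₀ K}
    (hc : IsSparse B D c)
    (hv : ∀ i : Fin n, (i : ℕ) < 2 * B → v i = (chebPoly c).eval (evalPoint ω ((i : ℕ) + 1))) :
    chebProny B D ω v = some c := by
  have hcard := hc.card_support_chebLaurent_le ω
  rw [chebProny, prony_eq_some (hω.mono (by omega))
    (fun e he => hc.abs_le_of_mem_support_chebLaurent ω he) (by omega) (fun k hk =>
      oddSeq_eq_sum_chebLaurent hK hω.1 hn hv (by rw [abs_lt]; constructor <;> omega)),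
    Option.bind_some, chebOfLaurent_chebLaurent hK hω.1 hc]

theorem natDegree_minGenerator_oddSeq_le {K : Type*} [Field K] (hK : (2 : K) ≠ 0) {B D n : ℕ}
    {ω : K} (hω : ω ≠ 0) (hn : 3 * B ≤ n) {v : Fin n → K} {c : ℕ →₀ K} (hc : IsSparse B D c)
    (hv : ∀ i : Fin n, v i = (chebPoly c).eval (evalPoint ω ((i : ℕ) + 1))) :
    (minGenerator (oddSeq v) (-(3 * (B : ℤ)) + 1) (6 * B)).natDegree ≤ 2 * B :=
  (natDegree_minGenerator_le hω fun k hk => oddSeq_eq_sum_chebLaurent hK hω hn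
    (fun i _ => hv i) (by rw [abs_lt]; constructor <;> omega)).trans
    (hc.card_support_chebLaurent_le ω)

/-! ### The Hankel + Toeplitz determinant -/

/-- On a block of correct values the Hankel + Toeplitz matrix factors through the term degrees,
because `z^(a+b) + z^(-(a+b)) + z^(a-b) + z^(-(a-b)) = (z^a + z^(-a)) (z^b + z^(-b))`. With at most
`B` terms the rank is at most `B`, so the matrix, of size `B + 1`, is singular. -/
theorem det_foldMatrix_eq_zero {K : Type*} [Field K] (hK : (2 : K) ≠ 0) {B D n : ℕ} {ω : K}
    (hω : ω ≠ 0) (hn : 3 * B ≤ n) {v : Fin n → K} {c : ℕ →₀ K} (hc : IsSparse B D c)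
    (hv : ∀ i : Fin n, v i = (chebPoly c).eval (evalPoint ω ((i : ℕ) + 1)))
    {r : ℤ} (hodd : Odd r) (hr0 : 0 < r) (hr : r < 2 * B) : (foldMatrix B v r).det = 0 := by
  let P : Matrix (Fin (B + 1)) c.support K := Matrix.of fun i δ =>
    c δ / 2 * (ω ^ ((δ : ℤ) * (r + 2 * (i : ℕ))) + ω ^ (-((δ : ℤ) * (r + 2 * (i : ℕ)))))
  let Q : Matrix c.support (Fin (B + 1)) K := Matrix.of fun δ j =>
    ω ^ ((δ : ℤ) * (2 * (j : ℕ))) + ω ^ (-((δ : ℤ) * (2 * (j : ℕ))))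
  have hval : ∀ m : ℤ, |r + 2 * m| < 2 * (3 * B : ℕ) →
      oddVal v |r + 2 * m| = chebValue ω c (r + 2 * m) := fun m hm => by
    rw [oddVal_eq_chebValue hK hω hn (fun i _ => hv i)
      (odd_abs.mpr (hodd.add_even (even_two_mul m))) (by rwa [abs_abs]), chebValue_abs]
  have hPQ : foldMatrix B v r = P * Q := by
    ext i j
    have hi := i.2
    have hj := j.2
    rw [foldMatrix, Matrix.of_apply, hval _ (by rw [abs_lt]; constructor <;> omega),
      hval _ (by rw [abs_lt]; constructor <;> omega), Matrix.mul_apply, chebValue, chebValue,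
      Finsupp.sum, Finsupp.sum, ← Finset.sum_add_distrib, ← Finset.sum_coe_sort]
    refine Finset.sum_congr rfl fun δ _ => ?_
    simp only [P, Q, Matrix.of_apply]
    rw [show ((δ : ℕ) : ℤ) * (r + 2 * ((i : ℕ) + (j : ℕ))) =
        δ * (r + 2 * (i : ℕ)) + δ * (2 * (j : ℕ)) by ring,
      show ((δ : ℕ) : ℤ) * (r + 2 * ((i : ℕ) - (j : ℕ))) =
        δ * (r + 2 * (i : ℕ)) + -(δ * (2 * (j : ℕ))) by ring, neg_add, neg_add, neg_neg]
    simp only [zpow_add₀ hω]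
    ring
  by_contra hdet
  have h1 := Matrix.rank_of_isUnit _ ((Matrix.isUnit_iff_isUnit_det _).mpr
    (isUnit_iff_ne_zero.mpr hdet))
  have h2 := (Matrix.rank_mul_le_left P Q).trans (Matrix.rank_le_card_width P)
  rw [← hPQ, h1, Fintype.card_fin, Fintype.card_coe] at h2
  have := hc.1
  omega

theorem map_oddVal {R S : Type*} [Zero R] [Zero S] {n : ℕ} (f : R → S) (hf : f 0 = 0)
    (v : Fin n → R) (k : ℤ) : f (oddVal v k) = oddVal (f ∘ v) k := by
  unfold oddVal
  split_ifs
  · rfl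
  · exact hf

theorem map_foldMatrix {R S : Type*} [Semiring R] [Semiring S] {n : ℕ} (f : R →+* S) (B : ℕ)
    (v : Fin n → R) (r : ℤ) : (foldMatrix B v r).map f = foldMatrix B (f ∘ v) r := by
  ext i j
  simp only [foldMatrix, Matrix.map_apply, Matrix.of_apply, map_add, map_oddVal f (map_zero f)]

/-- The index `r` of the matrix whose determinant is used to correct the value with zero-based
index `ℓ`. -/
def foldShift (B ℓ : ℕ) : ℤ :=
  if ℓ < B then 2 * ((ℓ : ℤ) + 1) - 1 else 2 * ((ℓ : ℤ) + 1 - (B : ℤ)) - 1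

theorem odd_foldShift (B ℓ : ℕ) : Odd (foldShift B ℓ) := by
  unfold foldShift
  split_ifs
  · exact ⟨ℓ, by ring⟩
  · exact ⟨ℓ - B, by ring⟩

theorem foldShift_pos (B ℓ : ℕ) : 0 < foldShift B ℓ := by
  unfold foldShift
  split_ifs <;> omega

theorem foldShift_lt {B ℓ : ℕ} (h : ℓ < 2 * B) : foldShift B ℓ < 2 * B := by
  unfold foldShift
  split_ifs <;> omega

theorem eval_symbolicDet {K : Type*} [Field K] {n : ℕ} (B : ℕ) (v : Fin n → K) (ℓ : Fin n)
    (ξ : K) : (symbolicDet B v ℓ).eval ξ =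
      (foldMatrix B (Function.update v ℓ ξ) (foldShift B ℓ)).det := by
  rw [symbolicDet, ← coe_evalRingHom, RingHom.map_det, RingHom.mapMatrix_apply, map_foldMatrix,
    foldShift]
  congr 2
  funext i
  rcases eq_or_ne i ℓ with rfl | h <;> simp [*]

/-- Substituting a variable for one value gives a linear matrix pencil. -/
theorem symbolicDet_eq_det_pencil {K : Type*} [Field K] {n : ℕ} (B : ℕ) (v : Fin n → K)
    (ℓ : Fin n) : symbolicDet B v ℓ =
      ((X : K[X]) • (foldMatrix B (Pi.single ℓ (1 : K)) (foldShift B ℓ)).map C +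
        (foldMatrix B (Function.update v ℓ 0) (foldShift B ℓ)).map C).det := by
  have hodd : ∀ k : ℤ, oddVal (Function.update (fun i => C (v i)) ℓ X) k =
      X * C (oddVal (Pi.single ℓ (1 : K)) k) + C (oddVal (Function.update v ℓ 0) k) := by
    intro k
    unfold oddVal
    split_ifs with h
    · generalize (⟨_, h⟩ : Fin n) = i
      rcases eq_or_ne i ℓ with rfl | h <;> simp [*]
    · simp
  rw [symbolicDet, ← foldShift]
  congr 1
  refine Matrix.ext fun i j => ?_
  simp only [foldMatrix, Matrix.add_apply, Matrix.smul_apply, Matrix.map_apply, Matrix.of_apply,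
    hodd, smul_eq_mul, C_add]
  ring

theorem natDegree_symbolicDet_le {K : Type*} [Field K] {n : ℕ} (B : ℕ) (v : Fin n → K)
    (ℓ : Fin n) : (symbolicDet B v ℓ).natDegree ≤ B + 1 := by
  rw [symbolicDet_eq_det_pencil]
  exact (natDegree_det_X_add_C_le _ _).trans_eq (Fintype.card_fin _)

theorem oddVal_single {R : Type*} [Zero R] {n : ℕ} (ℓ : Fin n) (a : R) {k : ℤ} (hodd : Odd k)
    (hk : 0 < k) : oddVal (Pi.single ℓ a) k = if k = 2 * (ℓ : ℤ) + 1 then a else 0 := by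
  obtain ⟨m, rfl⟩ := hodd
  have hℓ := ℓ.2
  unfold oddVal
  split_ifs with h1 h2 h2
  · rw [show (⟨_, h1⟩ : Fin n) = ℓ from Fin.ext (by simp only; omega), Pi.single_eq_same]
  · refine Pi.single_eq_of_ne (M := fun _ => R) (fun h => h2 ?_) a
    rw [← h]
    simp only
    omega
  · omega
  · rfl

/-- The coefficient of the variable in the Hankel + Toeplitz matrix is nonsingular: it is
upper triangular if `ℓ < B`, and supported on the antidiagonal otherwise, and the entries on the
diagonal or antidiagonal are `1`, except for one which is `2` because there the Hankel and the
Toeplitz part coincide. -/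
theorem det_foldMatrix_single_ne_zero {K : Type*} [Field K] (hK : (2 : K) ≠ 0) {B n : ℕ}
    {ℓ : Fin n} (hℓ : (ℓ : ℕ) < 2 * B) :
    (foldMatrix B (Pi.single ℓ (1 : K)) (foldShift B ℓ)).det ≠ 0 := by
  have hent : ∀ i j, foldMatrix B (Pi.single ℓ (1 : K)) (foldShift B ℓ) i j =
      (if |foldShift B ℓ + 2 * (((i : ℕ) : ℤ) + ((j : ℕ) : ℤ))| = 2 * (ℓ : ℤ) + 1
        then 1 else 0) +
      if |foldShift B ℓ + 2 * (((i : ℕ) : ℤ) - ((j : ℕ) : ℤ))| = 2 * (ℓ : ℤ) + 1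
        then 1 else 0 := by
    intro i j
    have hs : ∀ m : ℤ, Odd (foldShift B ℓ + 2 * m) := fun m =>
      (odd_foldShift B ℓ).add_even (even_two_mul m)
    have hp : ∀ m : ℤ, 0 < |foldShift B ℓ + 2 * m| := fun m =>
      abs_pos.mpr fun h => by simpa [h] using hs m
    rw [foldMatrix, Matrix.of_apply, oddVal_single ℓ 1 (odd_abs.mpr (hs _)) (hp _),
      oddVal_single ℓ 1 (odd_abs.mpr (hs _)) (hp _)]
  set M := foldMatrix B (Pi.single ℓ (1 : K)) (foldShift B ℓ)
  by_cases hlB : (ℓ : ℕ) < B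
  · have hshift : foldShift B ℓ = 2 * (ℓ : ℤ) + 1 := by rw [foldShift, if_pos hlB]; ring
    rw [hshift] at hent
    rw [Matrix.det_of_isUpperTriangular]
    · refine Finset.prod_ne_zero_iff.mpr fun i _ => ?_
      rw [hent, if_pos (show |2 * (ℓ : ℤ) + 1 + 2 * (((i : ℕ) : ℤ) - ((i : ℕ) : ℤ))| = _ by
        rw [abs_eq (by omega)]; omega)]
      split_ifs
      · rwa [one_add_one_eq_two]
      · rw [zero_add]
        exact one_ne_zero
    · intro i j hij
      have hij' : (j : ℕ) < i := hij
      rw [hent, if_neg, if_neg, add_zero] <;> · rw [abs_eq (by omega)]; omega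
  · have hshift : foldShift B ℓ = 2 * (ℓ : ℤ) + 1 - 2 * B := by
      rw [foldShift, if_neg hlB]; ring
    rw [hshift] at hent
    -- reversing the columns turns the antidiagonal into the diagonal
    have hperm := Matrix.det_permute' Fin.revPerm M
    intro h0
    rw [h0, mul_zero] at hperm
    refine absurd hperm ?_
    rw [Matrix.det_of_isUpperTriangular]
    · refine Finset.prod_ne_zero_iff.mpr fun i _ => ?_
      have hi := i.2
      rw [Matrix.submatrix_apply, hent, if_pos (by
        rw [abs_eq (by omega)]; simp only [id, Fin.revPerm_apply, Fin.val_rev]; omega)]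
      split_ifs
      · rwa [one_add_one_eq_two]
      · rw [add_zero]
        exact one_ne_zero
    · intro i j hij
      have hij' : (j : ℕ) < i := hij
      have hi := i.2
      rw [Matrix.submatrix_apply, hent, if_neg, if_neg, add_zero] <;>
      · rw [abs_eq (by omega)]; simp only [id, Fin.revPerm_apply, Fin.val_rev]; omega

/-- The determinant has degree exactly `B + 1`, whatever the received values are, so the true value
is never missed for want of finitely many roots. -/
theorem symbolicDet_ne_zero {K : Type*} [Field K] (hK : (2 : K) ≠ 0) {B n : ℕ} (v : Fin n → K)
    {ℓ : Fin n} (hℓ : (ℓ : ℕ) < 2 * B) : symbolicDet B v ℓ ≠ 0 := by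
  intro h
  have := coeff_det_X_add_C_card (foldMatrix B (Pi.single ℓ (1 : K)) (foldShift B ℓ))
    (foldMatrix B (Function.update v ℓ 0) (foldShift B ℓ))
  rw [← symbolicDet_eq_det_pencil, h, coeff_zero] at this
  exact det_foldMatrix_single_ne_zero hK hℓ this.symm

/-! ### Blocks with at most one error -/

theorem mem_tryBlock_iff {K : Type*} [Field K] {B D n : ℕ} {ω : K} {v w : Fin n → K}
    {c : ℕ →₀ K} : c ∈ tryBlock B D ω v w ↔
      chebProny B D ω w = some c ∧ (blockErrors ω v c).ncard ≤ 1 := by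
  unfold tryBlock
  cases h : chebProny B D ω w with
  | none => simp
  | some c' =>
    simp only [Option.some.injEq]
    split_ifs with h1
    · rw [List.mem_singleton]
      exact ⟨fun h => ⟨h.symm, h ▸ h1⟩, fun h => h.1.symm⟩
    · simp only [List.not_mem_nil, false_iff, not_and]
      rintro rfl
      exact h1

theorem length_tryBlock_le {K : Type*} [Field K] {B D n : ℕ} (ω : K) (v w : Fin n → K) :
    (tryBlock B D ω v w).length ≤ 1 := by
  unfold tryBlock
  split
  · exact Nat.zero_le _
  · split_ifs <;> simp

theorem isSparse_of_mem_oneErrorList {K : Type*} [Field K] {B D n : ℕ} {ω : K} {v : Fin n → K}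
    {c : ℕ →₀ K} (h : c ∈ oneErrorList B D ω v) : IsSparse B D c := by
  simp only [oneErrorList, List.mem_append, List.mem_flatMap] at h
  obtain h | ⟨ℓ, -, ξ, -, h⟩ := h
  · exact isSparse_of_chebProny_eq_some (mem_tryBlock_iff.mp h).1
  · split_ifs at h
    · exact isSparse_of_chebProny_eq_some (mem_tryBlock_iff.mp h).1
    · simp at h

/-- The one-error algorithm finds every sparse polynomial that disagrees with at most one value: an
error beyond the first `2 B` values is invisible to Prony's algorithm, and an error among them is
undone by one of the roots of the determinant. -/
theorem mem_oneErrorList {K : Type*} [Field K] (hK : (2 : K) ≠ 0) {B D n : ℕ} {ω : K}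
    (hω : HasOrderAtLeast ω (4 * D + 1)) (hn : 3 * B ≤ n) {v : Fin n → K} {c : ℕ →₀ K}
    (hc : IsSparse B D c) (herr : (blockErrors ω v c).ncard ≤ 1) :
    c ∈ oneErrorList B D ω v := by
  rw [oneErrorList, List.mem_append]
  by_cases hfirst : ∀ i : Fin n, (i : ℕ) < 2 * B →
      v i = (chebPoly c).eval (evalPoint ω ((i : ℕ) + 1))
  · exact Or.inl (mem_tryBlock_iff.mpr ⟨chebProny_eq_some hK hω (by omega) hc hfirst, herr⟩)
  right
  push Not at hfirst
  obtain ⟨ℓ, hℓ, hne⟩ := hfirst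
  -- `ℓ` is the only erroneous index, so substituting the true value corrects the whole block
  set ξ := (chebPoly c).eval (evalPoint ω ((ℓ : ℕ) + 1)) with hξ
  have hcorr : ∀ i : Fin n, Function.update v ℓ ξ i =
      (chebPoly c).eval (evalPoint ω ((i : ℕ) + 1)) := by
    intro i
    rcases eq_or_ne i ℓ with rfl | h
    · rw [Function.update_self]
    · rw [Function.update_of_ne h]
      by_contra hi
      exact h ((Set.ncard_le_one (Set.toFinite _)).mp herr i hi ℓ hne)
  rw [List.mem_flatMap]
  refine ⟨ℓ, by simpa using hℓ, ?_⟩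
  rw [List.mem_flatMap]
  refine ⟨ξ, (mem_rootList (symbolicDet_ne_zero hK v hℓ)).mpr ?_, ?_⟩
  · rw [eval_symbolicDet]
    exact det_foldMatrix_eq_zero hK hω.1 hn hc hcorr (odd_foldShift B ℓ) (foldShift_pos B ℓ)
      (foldShift_lt hℓ)
  · rw [if_pos (natDegree_minGenerator_oddSeq_le hK hω.1 hn hc hcorr), mem_tryBlock_iff]
    exact ⟨chebProny_eq_some hK hω (by omega) hc fun i _ => hcorr i, herr⟩

theorem length_flatMap_le {α β : Type*} (l : List α) (f : α → List β) {m : ℕ}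
    (h : ∀ a ∈ l, (f a).length ≤ m) : (l.flatMap f).length ≤ l.length * m := by
  rw [List.length_flatMap]
  refine (List.sum_le_card_nsmul _ m (by simpa using h)).trans_eq ?_
  rw [List.length_map, smul_eq_mul]

theorem length_filter_finRange_lt_le (n m : ℕ) :
    ((List.finRange n).filter fun ℓ : Fin n => ℓ.val < m).length ≤ m := by
  have hnodup : (((List.finRange n).filter fun ℓ : Fin n => ℓ.val < m).map Fin.val).Nodup :=
    ((List.nodup_finRange n).filter _).map Fin.val_injective
  rw [← List.length_map (f := Fin.val), ← List.toFinset_card_of_nodup hnodup]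
  refine (Finset.card_le_card fun x hx => ?_).trans_eq (Finset.card_range m)
  simp only [List.mem_toFinset, List.mem_map, List.mem_filter, decide_eq_true_eq] at hx
  obtain ⟨i, ⟨-, hi⟩, rfl⟩ := hx
  exact Finset.mem_range.mpr hi

/-- One candidate comes from the received block, and each of the `2 B` determinants has at most
`B + 1` roots. -/
theorem length_oneErrorList_le {K : Type*} [Field K] {B D n : ℕ} (ω : K) (v : Fin n → K) :
    (oneErrorList B D ω v).length ≤ 2 * B ^ 2 + 2 * B + 1 := by
  rw [oneErrorList, List.length_append]
  have h := length_flatMap_le ((List.finRange n).filter fun ℓ : Fin n => ℓ.val < 2 * B)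
    (fun ℓ => (rootList (symbolicDet B v ℓ)).flatMap fun ξ =>
        if (minGenerator (oddSeq (Function.update v ℓ ξ)) (-(3 * (B : ℤ)) + 1) (6 * B)).natDegree
            ≤ 2 * B
        then tryBlock B D ω v (Function.update v ℓ ξ) else []) (m := B + 1) fun ℓ _ => by
      refine (length_flatMap_le (m := 1) _ _ fun ξ _ => ?_).trans ?_
      · split_ifs
        · exact length_tryBlock_le _ _ _
        · exact Nat.zero_le _
      · rw [mul_one]
        exact (length_rootList_le _).trans (natDegree_symbolicDet_le B v ℓ)
  calc _ ≤ 1 + 2 * B * (B + 1) := add_le_add (length_tryBlock_le _ _ _)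
        (h.trans (Nat.mul_le_mul_right _ (length_filter_finRange_lt_le n (2 * B))))
    _ = _ := by ring

/-! ### Distribution of the errors over the blocks -/

theorem blockLength_of_even {B E : ℕ} (hE : ¬ Odd E) (σ : Fin (E / 2 + 1)) :
    blockLength B E σ = if (σ : ℕ) < E / 2 then 3 * B else 2 * B := by
  simp only [blockLength, hE, or_false]

theorem card_evalIndex (B E : ℕ) :
    Fintype.card (EvalIndex B E) = ⌊(3 / 2 : ℚ) * E + 2⌋₊ * B := by
  have hcard : Fintype.card (EvalIndex B E) = ∑ σ : Fin (E / 2 + 1), blockLength B E σ := by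
    simp [EvalIndex, Fintype.card_sigma]
  rw [hcard]
  rcases Nat.even_or_odd' E with ⟨k, rfl | rfl⟩
  · have hk : 2 * k / 2 = k := by omega
    have hfloor : ⌊(3 / 2 : ℚ) * (2 * k : ℕ) + 2⌋₊ = 3 * k + 2 := by
      rw [show (3 / 2 : ℚ) * (2 * k : ℕ) + 2 = ((3 * k + 2 : ℕ) : ℚ) by push_cast; ring,
        Nat.floor_natCast]
    rw [hfloor, Finset.sum_congr rfl fun σ _ =>
      blockLength_of_even (B := B) (Nat.not_odd_iff_even.mpr (even_two_mul k)) σ,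
      Fin.sum_univ_eq_sum_range (fun i => if i < 2 * k / 2 then 3 * B else 2 * B),
      Finset.sum_range_succ, if_neg (lt_irrefl _),
      Finset.sum_congr rfl fun i hi => if_pos (Finset.mem_range.mp hi), hk]
    simp only [Finset.sum_const, Finset.card_range, smul_eq_mul]
    ring
  · have hk : (2 * k + 1) / 2 = k := by omega
    have hfloor : ⌊(3 / 2 : ℚ) * (2 * k + 1 : ℕ) + 2⌋₊ = 3 * k + 3 := by
      rw [Nat.floor_eq_iff (by positivity)]
      push_cast
      constructor <;> linarith
    have hlen : ∀ σ, blockLength B (2 * k + 1) σ = 3 * B := fun σ =>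
      if_pos (Or.inr (odd_two_mul_add_one k))
    rw [hfloor, Finset.sum_congr rfl fun σ _ => hlen σ]
    simp only [Finset.sum_const, Finset.card_univ, Fintype.card_fin, smul_eq_mul, hk]
    ring

theorem ncard_errors_eq_sum_blockErrors {K : Type*} [Field K] {B E : ℕ}
    (ω : Fin (E / 2 + 1) → K) (a : EvalIndex B E → K) (c : ℕ →₀ K) :
    {p : EvalIndex B E |
      a p ≠ (chebPoly c).eval (evalPoint (ω p.1) ((p.2 : ℕ) + 1))}.ncard =
      ∑ σ, (blockErrors (ω σ) (fun i => a ⟨σ, i⟩) c).ncard := by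
  classical
  rw [Set.ncard_eq_toFinset_card']
  simp_rw [Set.ncard_eq_toFinset_card']
  rw [← Finset.card_sigma]
  congr 1
  ext ⟨σ, i⟩
  rw [Set.mem_toFinset, Finset.mem_sigma, Set.mem_toFinset]
  exact (and_iff_right (Finset.mem_univ σ)).symm

/-- With `E` errors in total, either some block of length `3 B` contains at most one of them, or the
last block has length `2 B` and contains none. -/
theorem exists_good_block {E : ℕ} {e : Fin (E / 2 + 1) → ℕ} (h : ∑ σ, e σ ≤ E) :
    ∃ σ : Fin (E / 2 + 1), ((σ : ℕ) < E / 2 ∨ Odd E) ∧ e σ ≤ 1 ∨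
      ¬ ((σ : ℕ) < E / 2 ∨ Odd E) ∧ e σ = 0 := by
  by_contra! hbad
  rcases Nat.even_or_odd E with hE | hE
  · have hlast := (hbad (Fin.last _)).2 ⟨by simp, Nat.not_odd_iff_even.mpr hE⟩
    have hinit : ∀ σ : Fin (E / 2), 2 ≤ e σ.castSucc := fun σ =>
      (hbad σ.castSucc).1 (Or.inl σ.2)
    have := Finset.sum_le_sum fun σ (_ : σ ∈ Finset.univ) => hinit σ
    rw [Fin.sum_univ_castSucc] at h
    simp only [Finset.sum_const, Finset.card_univ, Fintype.card_fin, smul_eq_mul] at this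
    obtain ⟨k, rfl⟩ := hE
    omega
  · have := Finset.sum_le_sum fun σ (_ : σ ∈ Finset.univ) =>
      Nat.succ_le_of_lt ((hbad σ).1 (Or.inr hE))
    simp only [Finset.sum_const, Finset.card_univ, Fintype.card_fin, smul_eq_mul] at this
    omega

theorem mem_listInterpolate {K : Type*} [Field K] (hK : (2 : K) ≠ 0) {B D E : ℕ}
    {ω : Fin (E / 2 + 1) → K} (hω : ∀ σ, HasOrderAtLeast (ω σ) (4 * D + 1))
    {a : EvalIndex B E → K} {c : ℕ →₀ K} (hc : IsSparse B D c)
    (herr : {p : EvalIndex B E |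
      a p ≠ (chebPoly c).eval (evalPoint (ω p.1) ((p.2 : ℕ) + 1))}.ncard ≤ E) :
    c ∈ listInterpolate B D E ω a := by
  rw [ncard_errors_eq_sum_blockErrors] at herr
  obtain ⟨σ, ⟨hσ, he⟩ | ⟨hσ, he⟩⟩ := exists_good_block herr
  · refine List.mem_flatMap.mpr ⟨σ, List.mem_finRange σ, ?_⟩
    rw [if_pos hσ]
    exact mem_oneErrorList hK (hω σ) (if_pos hσ).ge hc he
  · refine List.mem_flatMap.mpr ⟨σ, List.mem_finRange σ, ?_⟩
    rw [if_neg hσ, Option.mem_toList]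
    refine chebProny_eq_some hK (hω σ) (if_neg hσ).ge hc fun i _ => ?_
    by_contra hi
    rw [Set.ncard_eq_zero (Set.toFinite _)] at he
    exact Set.notMem_empty i (he ▸ hi)

theorem isSparse_of_mem_listInterpolate {K : Type*} [Field K] {B D E : ℕ}
    {ω : Fin (E / 2 + 1) → K} {a : EvalIndex B E → K} {c : ℕ →₀ K}
    (h : c ∈ listInterpolate B D E ω a) : IsSparse B D c := by
  obtain ⟨σ, -, h⟩ := List.mem_flatMap.mp h
  split_ifs at h
  · exact isSparse_of_mem_oneErrorList h
  · exact isSparse_of_chebProny_eq_some (Option.mem_toList.mp h)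

theorem length_listInterpolate_le_of_even {K : Type*} [Field K] {B D E : ℕ} (hE : Even E)
    (ω : Fin (E / 2 + 1) → K) (a : EvalIndex B E → K) :
    (listInterpolate B D E ω a).length ≤ E / 2 * (2 * B ^ 2 + 2 * B + 1) + 1 := by
  rw [listInterpolate, List.finRange_succ_last, List.flatMap_append, List.length_append]
  refine add_le_add ((length_flatMap_le (m := 2 * B ^ 2 + 2 * B + 1) _ _ fun σ hσ => ?_).trans_eq
    (by rw [List.length_map, List.length_finRange])) ?_
  · obtain ⟨τ, -, rfl⟩ := List.mem_map.mp hσ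
    rw [if_pos (Or.inl (show (τ.castSucc : ℕ) < E / 2 from τ.2))]
    exact length_oneErrorList_le _ _
  · rw [List.flatMap_singleton, if_neg (by simpa using hE)]
    cases chebProny B D (ω (Fin.last _)) fun i => a ⟨Fin.last _, i⟩ <;> simp

theorem length_listInterpolate_le_of_odd {K : Type*} [Field K] {B D E : ℕ} (hE : Odd E)
    (ω : Fin (E / 2 + 1) → K) (a : EvalIndex B E → K) :
    (listInterpolate B D E ω a).length ≤ (E / 2 + 1) * (2 * B ^ 2 + 2 * B + 1) := by
  refine (length_flatMap_le (m := 2 * B ^ 2 + 2 * B + 1) _ _ fun σ _ => ?_).trans_eq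
    (by rw [List.length_finRange])
  rw [if_pos (Or.inr hE)]
  exact length_oneErrorList_le _ _

end ChebInterp

open ChebInterp
theorem mainTheorem4 {K : Type*} [Field K] (hK : ringChar K ≠ 2) (B D E : ℕ)
    (ω : Fin (E / 2 + 1) → K) (hω : ∀ σ, HasOrderAtLeast (ω σ) (4 * D + 1))
    (a : EvalIndex B E → K) :
    -- the number of evaluations
    Fintype.card (EvalIndex B E) = ⌊(3 / 2 : ℚ) * E + 2⌋₊ * B ∧
    -- every sparse polynomial for which at most `E` values are erroneous is in the list
    (∀ c : ℕ →₀ K, IsSparse B D c →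
      {p : EvalIndex B E |
        a p ≠ (chebPoly c).eval (evalPoint (ω p.1) ((p.2 : ℕ) + 1))}.ncard ≤ E →
      c ∈ listInterpolate B D E ω a) ∧
    -- every member of the list is sparse
    (∀ c ∈ listInterpolate B D E ω a, IsSparse B D c) ∧
    -- bounds on the length of the list
    (Even E → (listInterpolate B D E ω a).length ≤ E / 2 * (2 * B ^ 2 + 2 * B + 1) + 1) ∧
    (Odd E → (listInterpolate B D E ω a).length ≤ (E / 2 + 1) * (2 * B ^ 2 + 2 * B + 1)) :=
  ⟨card_evalIndex B E,
    fun _ hc herr => mem_listInterpolate (Ring.two_ne_zero hK) hω hc herr,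
    fun _ hc => isSparse_of_mem_listInterpolate hc,
    fun hE => length_listInterpolate_le_of_even hE ω a,
    fun hE => length_listInterpolate_le_of_odd hE ω a⟩
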